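/- Let $n\ge 1$ and let $D_n=\langle \mu,\tau \mid \mu^n=\tau^2=1,\ \tau\mu=\mu^{-1}\tau\rangle$ be the dihedral group of order $2n$. Let $\pi:D_n\to U(n)$ be a projective unitary representation, i.e. for all $g,h\in D_n$, $\pi(gh)=\alpha\,\pi(g)\pi(h)$ for some unimodular scalar $\alpha=\alpha(g,h)\in\mathbb C$, and let $v\in\mathbb{C}^n$ be a unit vector. Let $$D_nv=[\,v_1,\ v_\mu,\ \ldots,\ v_{\mu^{n-1}},\ v_\tau,\ v_{\mu\tau},\ \ldots,\ v_{\mu^{n-1}\tau}\,],\qquad v_g:=\pi(g)v,$$ be the corresponding $n\times 2n$ dihedral configuration, and assume that it is regular: $\{\pi(\mu^i)v : 0\le i\le n-1\}$ is a basis of $\mathbb{C}^n$. Let $\Phi\in\mathbb{C}^{n\times 2n}$ be $D_nv$ or, more generally, any matrix switching equivalent to it, where $\Phi\sim\Psi$ (switching equivalence) means $\Psi=U\Phi\Pi^*$ with $U$ unitary and $\Pi$ the product of a unimodular diagonal matrix and a permutation matrix. Suppose that $\Phi$ is an $ETF(2n,n)$, i.e. its columns $\varphi_j$ are unit vectors,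 $\Phi\Phi^*=A I_n$ for some $A>0$, and $|\langle\varphi_i,\varphi_j\rangle|$ is constant for $i\ne j$. Then: 1. If $n\ge 2$, then $\pi$ is genuine projective: there are no group homomorphism $\rho:D_n\to U(n)$ and unitary $U$ such that, for every $g\in D_n$, $U\pi(g)U^*$ is a unimodular multiple of $\rho(g)$. 2. There are negacirculant matrices $P,Q\in\{\pm1\}^{n\times n}$ such that $$H=\begin{bmatrix}P&Q\\-Q^\top&P^\top\end{bmatrix}$$ is a skew Hadamard matrix (a $\pm1$ matrix with $HH^\top=2nI_{2n}$ and $H+H^\top=2I_{2n}$), and there is $\Psi\sim\Phi$ with $$\Psi^*\Psi=I_{2n}+\frac1{\sqrt{2n-1}}\begin{bmatrix} i(P-I_n)&Q\\ Q^\top& i(-P+I_n)\end{bmatrix}.$$ Here an $n\times n$ matrix $N$ is negacirculant if, for some $w_0,\dots,w_{n-1}$, $N_{ij}=w_{j-i}$ for $j\ge i$ and $N_{ij}=-w_{n+j-i}$ for $j<i$. -/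

import Mathlib

open Matrix

noncomputable section

namespace DihedralETF

/-- The negacirculant matrix with first row `v`. The difference `j - i` is taken in `Fin n`, that is
modulo `n`, so it is `j - i` when `i ≤ j` and `n + j - i` when `j < i`. -/
def negacirculant {R : Type*} [Neg R] {n : ℕ} (v : Fin n → R) : Matrix (Fin n) (Fin n) R :=
  Matrix.of fun i j => if i ≤ j then v (j - i) else -v (j - i)

/-- A matrix is negacirculant if it is the negacirculant matrix of some first row. -/
def IsNegacirculant {R : Type*} [Neg R] {n : ℕ} (N : Matrix (Fin n) (Fin n) R) : Prop :=
  ∃ v : Fin n → R, N = negacirculant v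

/-- A skew Hadamard matrix: a `±1` matrix `H` of order `m` with `H Hᵀ = m I` and `H + Hᵀ = 2 I`. -/
def IsSkewHadamard {ι : Type*} [Fintype ι] [DecidableEq ι] (H : Matrix ι ι ℤ) : Prop :=
  H.IsHadamard ∧ H + Hᵀ = (2 : ℤ) • (1 : Matrix ι ι ℤ)

/-- Projective equality: equality up to a unimodular scalar. -/
def ProjEq {m n : Type*} (A B : Matrix m n ℂ) : Prop :=
  ∃ α : ℂ, ‖α‖ = 1 ∧ A = α • B

/-- A projective unitary representation of `G` of dimension `n`. -/
def IsProjectiveRep {G : Type*} [Group G] {n : ℕ} (π : G → unitaryGroup (Fin n) ℂ) : Prop :=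
  ∀ g h : G, ProjEq (π (g * h) : Matrix (Fin n) (Fin n) ℂ) (π g * π h)

/-- Equivalence of projective unitary representations: unitary conjugacy up to phases. -/
def RepEquiv {G : Type*} {n : ℕ} (π π' : G → unitaryGroup (Fin n) ℂ) : Prop :=
  ∃ Q : unitaryGroup (Fin n) ℂ, ∀ g : G,
    ProjEq ((Q : Matrix (Fin n) (Fin n) ℂ) * (π g : Matrix (Fin n) (Fin n) ℂ) *
      (Q : Matrix (Fin n) (Fin n) ℂ)ᴴ) (π' g : Matrix (Fin n) (Fin n) ℂ)

/-- A genuine projective representation: a projective unitary representation which is not equivalent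
to a strict one, that is, to a group homomorphism into the unitary group. -/
def IsGenuineProjective {G : Type*} [Group G] {n : ℕ} (π : G → unitaryGroup (Fin n) ℂ) : Prop :=
  IsProjectiveRep π ∧ ¬ ∃ ρ : G →* unitaryGroup (Fin n) ℂ, RepEquiv π ρ

/-- The elements of the dihedral group of order `2 n`, listed as
`1, μ, …, μ ^ (n - 1), τ, μ τ, …, μ ^ (n - 1) τ`, with `μ = r 1` and `τ = sr 0`. -/
def dihedralElement (n : ℕ) : Fin n ⊕ Fin n → DihedralGroup n
  | Sum.inl i => DihedralGroup.r 1 ^ (i : ℕ)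
  | Sum.inr i => DihedralGroup.r 1 ^ (i : ℕ) * DihedralGroup.sr 0

/-- The `n × 2n` matrix whose columns are
`π(1) v, π(μ) v, …, π(μ ^ (n - 1)) v, π(τ) v, …, π(μ ^ (n - 1) τ) v`. -/
def dihedralConfiguration {n : ℕ} (π : DihedralGroup n → unitaryGroup (Fin n) ℂ)
    (v : EuclideanSpace ℂ (Fin n)) : Matrix (Fin n) (Fin n ⊕ Fin n) ℂ :=
  Matrix.of fun k j =>
    ((π (dihedralElement n j) : Matrix (Fin n) (Fin n) ℂ) *ᵥ WithLp.ofLp v) k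

/-- A dihedral configuration is regular if `π(1) v, π(μ) v, …, π(μ ^ (n - 1)) v` is a basis. -/
def IsRegular {n : ℕ} (π : DihedralGroup n → unitaryGroup (Fin n) ℂ)
    (v : EuclideanSpace ℂ (Fin n)) : Prop :=
  LinearIndependent ℂ (fun i : Fin n => (dihedralConfiguration π v)ᵀ (Sum.inl i)) ∧
    Submodule.span ℂ (Set.range fun i : Fin n => (dihedralConfiguration π v)ᵀ (Sum.inl i)) = ⊤

/-- An equiangular tight frame of unit vectors (the columns of `Φ`) in `ℂⁿ`. -/
structure IsETF {n : ℕ} {ι : Type*} [Fintype ι] (Φ : Matrix (Fin n) ι ℂ) : Prop where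
  unit_norm : ∀ j, (Φᴴ * Φ) j j = 1
  tight : ∃ A : ℝ, 0 < A ∧ Φ * Φᴴ = (A : ℂ) • (1 : Matrix (Fin n) (Fin n) ℂ)
  equiangular : ∃ c : ℝ, ∀ i j, i ≠ j → ‖(Φᴴ * Φ) i j‖ = c

/-- A phase monomial matrix: a unimodular diagonal matrix times a permutation matrix. -/
def IsPhaseMonomial {ι : Type*} [Fintype ι] [DecidableEq ι] (M : Matrix ι ι ℂ) : Prop :=
  ∃ (d : ι → ℂ) (σ : Equiv.Perm ι), (∀ i, ‖d i‖ = 1) ∧ M = diagonal d * σ.permMatrix ℂ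

/-- Switching equivalence of configurations: `Ψ = Q Φ M*` with `Q` unitary and `M` phase monomial. -/
def SwitchingEquiv {n : ℕ} {ι : Type*} [Fintype ι] [DecidableEq ι]
    (Φ Ψ : Matrix (Fin n) ι ℂ) : Prop :=
  ∃ (Q : unitaryGroup (Fin n) ℂ) (M : Matrix ι ι ℂ), IsPhaseMonomial M ∧
    Ψ = (Q : Matrix (Fin n) (Fin n) ℂ) * Φ * Mᴴ

/-- The matrix `I + (2n - 1)^(-1/2) [i(P - I), Q; Qᵀ, i(-P + I)]`. -/
def gramOfBlocks {n : ℕ} (P Q : Matrix (Fin n) (Fin n) ℤ) :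
    Matrix (Fin n ⊕ Fin n) (Fin n ⊕ Fin n) ℂ :=
  let P' : Matrix (Fin n) (Fin n) ℂ := P.map (fun a : ℤ => (a : ℂ))
  let Q' : Matrix (Fin n) (Fin n) ℂ := Q.map (fun a : ℤ => (a : ℂ))
  1 + ((1 / Real.sqrt (2 * (n : ℝ) - 1) : ℝ) : ℂ) •
    fromBlocks (Complex.I • (P' - 1)) Q' Q'ᵀ (Complex.I • (-P' + 1))

end DihedralETF

end

/-! Rescale `π` on the generators to unitaries M, T with T² = (TM)² = 1. Then Mⁿ is a scalar α, and
conjugation by T forces α = ±1. Phases only switch the frame, so it suffices to study the Gram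
matrix G of the columns Mⁱv, MⁱTv. It has blocks A, B, Bᵀ, Aᵀ, where A and B have entries a(j - i)
and b(j - i) for a(k) = ⟨v, Mᵏv⟩ and b(k) = ⟨v, MᵏTv⟩. Both symbols pick up the factor α when k
grows by n, so the blocks and their transposes commute. A is Hermitian, and B is real because each
MᵏT is an involution.

Tightness gives G² = 2G and regularity makes A invertible; together they force A + Aᵀ = 2I
(`add_transpose_eq_two`), so A is imaginary off the diagonal. All off-diagonal entries of G have
modulus s = 1/√(2n - 1), hence A = I + is(P - I) and B = sQ with sign matrices P, Q, and G² = 2G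
becomes the Hadamard identity (`exists_sign_matrices`).

For n ≥ 2 the Hadamard order 2n forces n to be even. If α were 1, a(n/2) would be both real and
imaginary, hence zero, which equiangularity forbids. So α = -1. This makes P and Q negacirculant,
and it obstructs linearization: for even n, rescalings preserving T² = (TM)² = 1 cannot change Mⁿ
(`pow_eq_one_of_even`). -/

open Matrix

noncomputable section

namespace DihedralETF

/-! ### Unimodular scalar matrices -/

/-- The unimodular scalar matrices, as a homomorphism into the unitary group. -/
def phase (n : ℕ) : Circle →* unitaryGroup (Fin n) ℂ where
  toFun z := ⟨(z : ℂ) • 1, by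
    rw [mem_unitaryGroup_iff, star_smul, star_one, smul_mul_smul_comm, one_mul]
    have h : (z : ℂ) * star (z : ℂ) = 1 := by
      rw [← starRingEnd_apply, Complex.mul_conj, Circle.normSq_coe, Complex.ofReal_one]
    rw [h, one_smul]⟩
  map_one' := by ext; simp
  map_mul' z w := by
    apply Subtype.ext
    simp [smul_smul, mul_comm]

theorem coe_phase_mul {n : ℕ} (z : Circle) (g : unitaryGroup (Fin n) ℂ) :
    ((phase n z * g : unitaryGroup (Fin n) ℂ) : Matrix (Fin n) (Fin n) ℂ) =
      (z : ℂ) • (g : Matrix (Fin n) (Fin n) ℂ) := by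
  change ((z : ℂ) • (1 : Matrix (Fin n) (Fin n) ℂ)) * (g : Matrix (Fin n) (Fin n) ℂ) = _
  rw [smul_mul_assoc, one_mul]

theorem phase_commute {n : ℕ} (z : Circle) (g : unitaryGroup (Fin n) ℂ) :
    Commute (phase n z) g := by
  apply Subtype.ext
  rw [coe_phase_mul]
  change _ = (g : Matrix (Fin n) (Fin n) ℂ) * ((z : ℂ) • (1 : Matrix (Fin n) (Fin n) ℂ))
  rw [mul_smul_comm, mul_one]

theorem phase_injective {n : ℕ} (hn : 1 ≤ n) : Function.Injective (phase n) := by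
  intro z w h
  have h1 := congrFun (congrFun (congrArg Subtype.val h) ⟨0, hn⟩) ⟨0, hn⟩
  exact Circle.ext (by simpa [phase] using h1)

theorem projEq_iff_exists_phase {n : ℕ} (g h : unitaryGroup (Fin n) ℂ) :
    ProjEq (g : Matrix (Fin n) (Fin n) ℂ) h ↔ ∃ z : Circle, g = phase n z * h := by
  constructor
  · rintro ⟨α, hα, h1⟩
    obtain ⟨z, rfl⟩ : ∃ z : Circle, (z : ℂ) = α := ⟨⟨α, mem_sphere_zero_iff_norm.2 hα⟩, rfl⟩
    exact ⟨z, Subtype.ext (h1.trans (coe_phase_mul z h).symm)⟩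
  · rintro ⟨z, rfl⟩
    exact ⟨z, Circle.norm_coe z, coe_phase_mul z h⟩

theorem exists_circle_sq (z : Circle) : ∃ s : Circle, s * s = z := by
  obtain ⟨t, rfl⟩ := Circle.exp_surjective z
  exact ⟨Circle.exp (t / 2), by rw [← Circle.exp_add]; congr 1; ring⟩

/-! ### Projective representations of dihedral groups -/

section Group

variable {G : Type*} [Group G] (ι : Circle →* G)

/-- A projective representation of a dihedral group can be rescaled on the generators so that
the dihedral relations hold, except that the power of the rotation is only central. -/
theorem exists_dihedral_lift (hι : ∀ z g, Commute (ι z) g) {n : ℕ} (π : DihedralGroup n → G)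
    (hπ : ∀ g h, ∃ z, π (g * h) = ι z * (π g * π h)) :
    ∃ M T : G, T * T = 1 ∧ T * M * (T * M) = 1 ∧ (∃ α, M ^ n = ι α) ∧
      (∃ z, M = ι z * π (DihedralGroup.r 1)) ∧ (∃ z, T = ι z * π (DihedralGroup.sr 0)) ∧
      (∀ i : ℕ, ∃ z, M ^ i = ι z * π (DihedralGroup.r 1 ^ i)) ∧
      ∀ i : ℕ, ∃ z, M ^ i * T = ι z * π (DihedralGroup.r 1 ^ i * DihedralGroup.sr 0) := by
  -- Modulo scalars `π` is a homomorphism, so every dihedral relation holds for lifts up to a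
  -- scalar.
  have : ι.range.Normal := ⟨by
    rintro _ ⟨z, rfl⟩ g
    exact ⟨z, by rw [← (hι z g).eq, mul_inv_cancel_right]⟩⟩
  let q : G →* G ⧸ ι.range := QuotientGroup.mk' _
  have hq : ∀ g h : G, q g = q h → ∃ z, g = ι z * h := by
    intro g h hgh
    obtain ⟨z, hz⟩ := QuotientGroup.eq.1 hgh.symm
    exact ⟨z, by rw [(hι z h).eq, hz, mul_inv_cancel_left]⟩
  have hq1 : ∀ z, q (ι z) = 1 := fun z => (QuotientGroup.eq_one_iff _).2 ⟨z, rfl⟩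
  have hfmul : ∀ g h, q (π (g * h)) = q (π g) * q (π h) := by
    intro g h
    obtain ⟨z, hz⟩ := hπ g h
    rw [hz, map_mul, map_mul, hq1, one_mul]
  let f : DihedralGroup n →* G ⧸ ι.range := MonoidHom.mk' (fun g => q (π g)) hfmul
  have hf : ∀ g, q (π g) = f g := fun _ => rfl
  have hrefl : (DihedralGroup.sr 0 : DihedralGroup n) * DihedralGroup.r 1 *
      (DihedralGroup.sr 0 * DihedralGroup.r 1) = 1 := by
    rw [DihedralGroup.sr_mul_r, DihedralGroup.sr_mul_self]
  obtain ⟨z, hz⟩ := hq (π (DihedralGroup.sr 0) * π (DihedralGroup.sr 0)) 1 (by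
    rw [map_mul, hf, ← map_mul, DihedralGroup.sr_mul_self, map_one, map_one])
  -- T occurs twice in T², so a square root absorbs the scalar. The same device fixes M through
  -- (TM)².
  obtain ⟨s, hs⟩ := exists_circle_sq z⁻¹
  obtain ⟨T, hT⟩ : ∃ T, T = ι s * π (DihedralGroup.sr 0) := ⟨_, rfl⟩
  have hqT : q T = f (DihedralGroup.sr 0) := by rw [hT, map_mul, hq1, one_mul, hf]
  have hTT : T * T = 1 := by
    rw [hT, ((hι s _).symm).mul_mul_mul_comm, hz, ← map_mul, hs, mul_one, ← map_mul,
      inv_mul_cancel, map_one]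
  obtain ⟨w, hw⟩ := hq (T * π (DihedralGroup.r 1) * (T * π (DihedralGroup.r 1))) 1 (by
    rw [map_mul, map_mul, hqT, hf, ← map_mul, ← map_mul, hrefl, map_one, map_one])
  obtain ⟨t, ht⟩ := exists_circle_sq w⁻¹
  obtain ⟨M, hM⟩ : ∃ M, M = ι t * π (DihedralGroup.r 1) := ⟨_, rfl⟩
  have hqM : q M = f (DihedralGroup.r 1) := by rw [hM, map_mul, hq1, one_mul, hf]
  have hTM : T * M = ι t * (T * π (DihedralGroup.r 1)) := by
    rw [hM, ← mul_assoc, ← (hι t T).eq, mul_assoc]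
  refine ⟨M, T, hTT, ?_, ?_, ⟨t, hM⟩, ⟨s, hT⟩, fun i => hq _ _ ?_, fun i => hq _ _ ?_⟩
  · rw [hTM, ((hι t _).symm).mul_mul_mul_comm, hw, ← map_mul, ht, mul_one, ← map_mul,
      inv_mul_cancel, map_one]
  · obtain ⟨α, hα⟩ := hq (M ^ n) 1 (by
      rw [map_pow, hqM, ← map_pow, DihedralGroup.r_one_pow_n, map_one, map_one])
    exact ⟨α, by rw [hα, mul_one]⟩
  · rw [map_pow, hqM, hf, map_pow]
  · rw [map_mul, map_pow, hqM, hqT, hf, map_mul, map_pow]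

/-- If a rescaling of the generators satisfies all dihedral relations and `n` is even, then the
rotation of any rescaling with the two reflection relations has order dividing `n`. -/
theorem pow_eq_one_of_even (hι : ∀ z g, Commute (ι z) g) (hinj : Function.Injective ι) {n : ℕ}
    (hn : Even n) {M T M' T' : G} (hT : T * T = 1) (hTM : T * M * (T * M) = 1)
    (hT' : T' * T' = 1) (hTM' : T' * M' * (T' * M') = 1) (hM' : M' ^ n = 1)
    (hM : ∃ s, M = ι s * M') (hTT' : ∃ t, T = ι t * T') : M ^ n = 1 := by
  obtain ⟨s, rfl⟩ := hM
  obtain ⟨t, rfl⟩ := hTT'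
  -- The reflection relations for both pairs give t² = 1 and (ts)² = 1, so s² = 1, and sⁿ = 1 for
  -- even n.
  have ht : t * t = 1 := by
    rw [((hι t _).symm).mul_mul_mul_comm, hT', mul_one, ← map_mul] at hT
    exact hinj (hT.trans (map_one ι).symm)
  have hts : ι t * T' * (ι s * M') = ι (t * s) * (T' * M') := by
    rw [((hι s _).symm).mul_mul_mul_comm, ← map_mul]
  have hs : t * s * (t * s) = 1 := by
    rw [hts, ((hι (t * s) _).symm).mul_mul_mul_comm, hTM', mul_one, ← map_mul] at hTM
    exact hinj (hTM.trans (map_one ι).symm)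
  rw [mul_mul_mul_comm, ht, one_mul] at hs
  obtain ⟨m, rfl⟩ := hn
  rw [(hι s M').mul_pow, hM', mul_one, ← map_pow, pow_add, ← mul_pow, hs, one_pow, map_one]

theorem conj_pow_eq_inv {M T : G} (hT : T * T = 1) (hTM : T * M * (T * M) = 1) (k : ℤ) :
    T * M ^ k * T = (M ^ k)⁻¹ := by
  have hTi : T⁻¹ = T := inv_eq_of_mul_eq_one_left hT
  have h1 : T * M * T⁻¹ = M⁻¹ := by
    rw [hTi]
    exact eq_inv_of_mul_eq_one_left (by rw [mul_assoc (T * M), hTM])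
  calc T * M ^ k * T = T * M ^ k * T⁻¹ := by rw [hTi]
    _ = (M ^ k)⁻¹ := by rw [← conj_zpow, h1, _root_.inv_zpow]

/-- Conjugation by T inverts Mⁿ but fixes the central element `ι α`, so α = α⁻¹. -/
theorem central_sq_eq_one (hι : ∀ z g, Commute (ι z) g) (hinj : Function.Injective ι) {n : ℕ}
    {M T : G} {α : Circle} (hT : T * T = 1) (hTM : T * M * (T * M) = 1) (hM : M ^ n = ι α) :
    α * α = 1 := by
  have h := conj_pow_eq_inv hT hTM n
  rw [zpow_natCast, hM, ← (hι α T).eq, mul_assoc, hT, mul_one] at h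
  apply hinj
  rw [map_mul, map_one]
  nth_rewrite 1 [h]
  exact inv_mul_cancel _

end Group

/-! ### Twisted circulant matrices -/

/-- The matrix with entries `a (j - i)`, where the difference is an integer. -/
def toeplitz (n : ℕ) (a : ℤ → ℂ) : Matrix (Fin n) (Fin n) ℂ :=
  Matrix.of fun i j => a ((j : ℤ) - (i : ℤ))

theorem sum_fin_reflect {n : ℕ} {f : ℤ → ℂ} (hf : ∀ k, f (k + n) = f k) (c : ℤ) :
    ∑ k : Fin n, f k = ∑ k : Fin n, f (c - k) := by
  cases n with
  | zero => simp
  | succ m =>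
    let F : ZMod (m + 1) → ℂ := fun z => f (z.val : ℤ)
    have hF : ∀ k : ℤ, F k = f k := by
      intro k
      have hp : Function.Periodic f ((m + 1 : ℕ) : ℤ) := hf
      simp only [F, ZMod.val_intCast]
      rw [Int.emod_def, mul_comm]
      exact hp.sub_int_mul_eq _
    -- `ZMod (m + 1)` unfolds to `Fin (m + 1)`; there the reflection is a bijection.
    have h1 : ∀ g : ℤ → ℂ, ∑ k : Fin (m + 1), g k = ∑ z : ZMod (m + 1), g (z.val : ℤ) :=
      fun g => rfl
    rw [h1 f, h1 fun k => f (c - k)]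
    change ∑ z, F z = _
    rw [← (Equiv.subLeft (c : ZMod (m + 1))).sum_comp]
    refine Finset.sum_congr rfl fun z _ => ?_
    rw [← hF, Int.cast_sub, Int.cast_natCast, ZMod.natCast_zmod_val]
    rfl

/-- Toeplitz matrices whose symbols are quasiperiodic with the same multiplier commute. -/
theorem toeplitz_mul_comm {n : ℕ} {α : ℂ} {a b : ℤ → ℂ} (ha : ∀ k, a (k + n) = α * a k)
    (hb : ∀ k, b (k + n) = α * b k) : toeplitz n a * toeplitz n b = toeplitz n b * toeplitz n a := by
  ext i j
  simp only [mul_apply, toeplitz, of_apply]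
  -- The summand is n-periodic, since the multipliers of a and b cancel; k ↦ i + j - k exchanges the
  -- two arguments.
  rw [sum_fin_reflect (f := fun k => a (k - i) * b (j - k)) (c := i + j)]
  · refine Finset.sum_congr rfl fun k _ => ?_
    rw [mul_comm]
    congr 2 <;> ring
  · intro k
    have h1 := hb (j - (k + n))
    rw [show (j : ℤ) - (k + n) + n = j - k by ring] at h1
    rw [show k + (n : ℤ) - i = k - i + n by ring, ha, h1]
    ring

theorem toeplitz_transpose (n : ℕ) (a : ℤ → ℂ) :
    (toeplitz n a)ᵀ = toeplitz n fun k => a (-k) := by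
  ext i j
  simp [toeplitz]

/-- Reversal replaces α by α⁻¹ = α, so transposes stay in the same commuting family. -/
theorem neg_index_quasiperiodic {n : ℕ} {α : ℂ} {a : ℤ → ℂ} (hα : α * α = 1)
    (ha : ∀ k, a (k + n) = α * a k) (k : ℤ) : a (-(k + n)) = α * a (-k) := by
  have h := ha (-(k + n))
  rw [show -(k + (n : ℤ)) + n = -k by ring] at h
  rw [h, ← mul_assoc, hα, one_mul]

theorem isNegacirculant_of_map_eq_toeplitz {n : ℕ} {N : Matrix (Fin n) (Fin n) ℤ} {a : ℤ → ℂ}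
    (ha : ∀ k, a (k + n) = -a k) (hN : N.map (fun x : ℤ => (x : ℂ)) = toeplitz n a) :
    IsNegacirculant N := by
  have hN' : ∀ i j, (N i j : ℂ) = a ((j : ℤ) - i) := fun i j => congrFun (congrFun hN i) j
  cases n with
  | zero => exact ⟨fun _ => 0, by ext i; exact i.elim0⟩
  | succ m =>
    refine ⟨N 0, ?_⟩
    ext i j
    apply Int.cast_injective (α := ℂ)
    rw [hN', negacirculant, of_apply]
    split_ifs with h
    · rw [hN', Fin.sub_val_of_le h, Nat.cast_sub h]
      simp
    -- Below the diagonal the `Fin` difference wraps to n + j - i, and the multiplier -1 supplies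
    -- the sign.
    · rw [Int.cast_neg, hN', ← neg_eq_iff_eq_neg, ← ha]
      push Not at h
      rw [Fin.coe_sub_iff_lt.2 h, Nat.cast_sub (by omega)]
      congr 1
      have := i.isLt
      have := Fin.lt_def.1 h
      have h0 : ((0 : Fin (m + 1)) : ℕ) = 0 := rfl
      push_cast
      omega

theorem isNegacirculant_one {N : Matrix (Fin 1) (Fin 1) ℤ} : IsNegacirculant N :=
  ⟨N 0, by ext i j; fin_cases i; fin_cases j; rfl⟩

/-! ### The block equations -/

open scoped ComplexOrder in
/-- The key rigidity statement: the off-diagonal entries of the first block are imaginary. -/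
theorem add_transpose_eq_two {n : ℕ} {A B : Matrix (Fin n) (Fin n) ℂ} (hA : IsUnit A)
    (hAH : Aᴴ = A) (htr : A.trace = n) (hATB : Aᵀ * B = B * Aᵀ)
    (hAAT : Aᵀ * A = A * Aᵀ) (h11 : A * A + B * Bᵀ = (2 : ℂ) • A)
    (h12 : A * B + B * Aᵀ = (2 : ℂ) • B) : A + Aᵀ = (2 : ℂ) • 1 := by
  obtain ⟨S, hS⟩ : ∃ S, S = A + Aᵀ - (2 : ℂ) • (1 : Matrix (Fin n) (Fin n) ℂ) := ⟨_, rfl⟩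
  have hAT : Aᵀ = S - A + (2 : ℂ) • 1 := by rw [hS]; abel
  -- Since Aᵀ commutes with B, `h12` reads (A + Aᵀ)B = 2B.
  have hSB : S * B = 0 := by
    rw [hS, sub_mul, add_mul, hATB, h12, smul_mul_assoc, one_mul, sub_self]
  -- Cancel A on the right: S(2A - A²) = SBBᵀ = 0.
  have h1 : S * ((2 : ℂ) • 1 - A) = 0 := by
    apply hA.mul_left_injective
    beta_reduce
    rw [zero_mul, mul_assoc, sub_mul, smul_mul_assoc, one_mul, ← h11, add_sub_cancel_left,
      ← mul_assoc, hSB, zero_mul]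
  have hST : Sᵀ = S := by
    rw [hS, transpose_sub, transpose_add, transpose_transpose, transpose_smul, transpose_one,
      add_comm Aᵀ]
  have hSA : S * Aᵀ = Aᵀ * S := by
    rw [hS, sub_mul, add_mul, mul_sub, mul_add, hAAT, smul_mul_assoc, one_mul, mul_smul_comm,
      mul_one]
  have h2 : S * ((2 : ℂ) • 1 - Aᵀ) = 0 := by
    have h := congrArg transpose h1
    rw [transpose_mul, transpose_zero, hST, transpose_sub, transpose_smul, transpose_one, sub_mul,
      ← hSA, smul_mul_assoc, one_mul] at h
    rw [mul_sub, mul_smul_comm, mul_one, h]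
  -- The factors 2 - A and 2 - Aᵀ add up to 2 - S.
  have hSS : S * S = (2 : ℂ) • S := by
    have h3 : S * ((2 : ℂ) • 1 - A) + S * ((2 : ℂ) • 1 - Aᵀ) = (2 : ℂ) • S - S * S := by
      rw [← mul_add, hAT]
      simp only [mul_add, mul_sub, mul_smul_comm, mul_one]
      module
    rw [h1, h2, add_zero] at h3
    exact (sub_eq_zero.1 h3.symm).symm
  have hSH : Sᴴ = S := by
    have h4 : (Aᵀ)ᴴ = Aᵀ := by
      rw [conjTranspose, transpose_transpose, ← conjTranspose_transpose, hAH]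
    rw [hS, conjTranspose_sub, conjTranspose_add, h4, hAH, conjTranspose_smul, conjTranspose_one]
    simp
  have htrS : S.trace = 0 := by
    rw [hS, trace_sub, trace_add, trace_transpose, htr, trace_smul, trace_one, Fintype.card_fin,
      smul_eq_mul]
    ring
  -- S is Hermitian with S² = 2S and trace zero, so the trace of SᴴS vanishes.
  have hzero : S = 0 := by
    rw [← trace_conjTranspose_mul_self_eq_zero_iff, hSH, hSS, trace_smul, htrS, smul_zero]
  rw [hzero] at hS
  exact sub_eq_zero.1 hS.symm

/-! ### Switching equivalence -/

theorem phaseMonomial_conj_apply {ι : Type*} [Fintype ι] [DecidableEq ι] (d : ι → ℂ)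
    (σ : Equiv.Perm ι) (N : Matrix ι ι ℂ) (i j : ι) :
    (diagonal d * σ.permMatrix ℂ * N * (diagonal d * σ.permMatrix ℂ)ᴴ) i j =
      d i * N (σ i) (σ j) * star (d j) := by
  have h : ∀ (K : Matrix ι ι ℂ) k l, (diagonal d * σ.permMatrix ℂ * K) k l = d k * K (σ k) l := by
    intro K k l
    rw [mul_assoc, diagonal_mul, Equiv.Perm.permMatrix, PEquiv.toMatrix_toPEquiv_mul]
    rfl
  rw [mul_assoc, h, ← conjTranspose_conjTranspose N, ← conjTranspose_mul, conjTranspose_apply, h,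
    conjTranspose_apply, star_mul', star_star, conjTranspose_conjTranspose]
  ring

theorem norm_one_mul_star {z : ℂ} (hz : ‖z‖ = 1) : z * star z = 1 := by
  rw [← starRingEnd_apply, Complex.mul_conj, Complex.normSq_eq_norm_sq, hz]
  simp

theorem IsPhaseMonomial.mul_conjTranspose {ι : Type*} [Fintype ι] [DecidableEq ι]
    {M : Matrix ι ι ℂ} (hM : IsPhaseMonomial M) : M * Mᴴ = 1 := by
  obtain ⟨d, σ, hd, rfl⟩ := hM
  ext i j
  have h := phaseMonomial_conj_apply d σ 1 i j
  rw [mul_one] at h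
  rw [h]
  by_cases hij : i = j
  · subst hij
    rw [one_apply_eq, one_apply_eq, mul_one, norm_one_mul_star (hd i)]
  · rw [one_apply_ne hij, one_apply_ne (fun h => hij (σ.injective h)), mul_zero, zero_mul]

theorem IsPhaseMonomial.conjTranspose_mul {ι : Type*} [Fintype ι] [DecidableEq ι]
    {M : Matrix ι ι ℂ} (hM : IsPhaseMonomial M) : Mᴴ * M = 1 :=
  mul_eq_one_comm.1 hM.mul_conjTranspose

theorem IsPhaseMonomial.diagonal_mul {ι : Type*} [Fintype ι] [DecidableEq ι]
    {M : Matrix ι ι ℂ} (hM : IsPhaseMonomial M) {e : ι → ℂ} (he : ∀ i, ‖e i‖ = 1) :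
    IsPhaseMonomial (diagonal e * M) := by
  obtain ⟨d, σ, hd, rfl⟩ := hM
  refine ⟨fun i => e i * d i, σ, fun i => by rw [norm_mul, he, hd, one_mul], ?_⟩
  rw [← mul_assoc, diagonal_mul_diagonal]

theorem SwitchingEquiv.mul_diagonal {n : ℕ} {ι : Type*} [Fintype ι] [DecidableEq ι]
    {Φ Ψ : Matrix (Fin n) ι ℂ} (h : SwitchingEquiv Φ Ψ) {e : ι → ℂ} (he : ∀ i, ‖e i‖ = 1) :
    SwitchingEquiv Φ (Ψ * diagonal e) := by
  obtain ⟨Q, M, hM, rfl⟩ := h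
  refine ⟨Q, diagonal (star e) * M, hM.diagonal_mul fun i => by simp [he], ?_⟩
  rw [Matrix.conjTranspose_mul, diagonal_conjTranspose, star_star, Matrix.mul_assoc _ Mᴴ]

theorem unitary_conjTranspose_mul {n : ℕ} (Q : unitaryGroup (Fin n) ℂ) :
    (Q : Matrix (Fin n) (Fin n) ℂ)ᴴ * (Q : Matrix (Fin n) (Fin n) ℂ) = 1 :=
  UnitaryGroup.star_mul_self Q

theorem IsETF.of_switchingEquiv {n : ℕ} {ι : Type*} [Fintype ι] [DecidableEq ι]
    {Φ Ψ : Matrix (Fin n) ι ℂ} (hΦ : IsETF Φ) (h : SwitchingEquiv Φ Ψ) : IsETF Ψ := by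
  obtain ⟨Q, M, hM, rfl⟩ := h
  have hgram : ((Q : Matrix (Fin n) (Fin n) ℂ) * Φ * Mᴴ)ᴴ * ((Q : Matrix (Fin n) (Fin n) ℂ) * Φ * Mᴴ)
      = M * (Φᴴ * Φ) * Mᴴ := by
    calc _ = M * (Φᴴ * ((Q : Matrix (Fin n) (Fin n) ℂ)ᴴ * (Q : Matrix (Fin n) (Fin n) ℂ)) * Φ) * Mᴴ := by
          simp only [Matrix.conjTranspose_mul, conjTranspose_conjTranspose, Matrix.mul_assoc]
      _ = _ := by rw [unitary_conjTranspose_mul, Matrix.mul_one]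
  refine ⟨fun j => ?_, ?_, ?_⟩
  · rw [hgram]
    obtain ⟨d, σ, hd, rfl⟩ := hM
    rw [phaseMonomial_conj_apply, hΦ.unit_norm, mul_one, norm_one_mul_star (hd j)]
  · obtain ⟨A, hA, h⟩ := hΦ.tight
    refine ⟨A, hA, ?_⟩
    calc _ = (Q : Matrix (Fin n) (Fin n) ℂ) * (Φ * (Mᴴ * M) * Φᴴ) * (Q : Matrix (Fin n) (Fin n) ℂ)ᴴ := by
          simp only [Matrix.conjTranspose_mul, conjTranspose_conjTranspose, Matrix.mul_assoc]
      _ = (A : ℂ) • ((Q : Matrix (Fin n) (Fin n) ℂ) * (Q : Matrix (Fin n) (Fin n) ℂ)ᴴ) := by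
          rw [hM.conjTranspose_mul, Matrix.mul_one, h, mul_smul_comm, smul_mul_assoc, Matrix.mul_one]
      _ = _ := by rw [mul_eq_one_comm.1 (unitary_conjTranspose_mul Q)]
  · obtain ⟨c, hc⟩ := hΦ.equiangular
    refine ⟨c, fun i j hij => ?_⟩
    rw [hgram]
    obtain ⟨d, σ, hd, rfl⟩ := hM
    rw [phaseMonomial_conj_apply, norm_mul, norm_mul, norm_star, hd, hd, one_mul, mul_one]
    exact hc _ _ fun h => hij (σ.injective h)

/-! ### Gram matrices of equiangular tight frames -/

/-- Comparing the traces of ΦᴴΦ and ΦΦᴴ gives 2n = An, so the frame constant is 2. -/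
theorem IsETF.gram_sq {n : ℕ} (hn : 1 ≤ n) {Φ : Matrix (Fin n) (Fin n ⊕ Fin n) ℂ} (h : IsETF Φ) :
    (Φᴴ * Φ) * (Φᴴ * Φ) = (2 : ℂ) • (Φᴴ * Φ) := by
  obtain ⟨A, -, hA⟩ := h.tight
  have htr : (Φᴴ * Φ).trace = (2 * n : ℂ) := by
    simp [trace, h.unit_norm]
    ring
  rw [trace_mul_comm, hA, trace_smul, trace_one, Fintype.card_fin, smul_eq_mul] at htr
  have hn0 : (n : ℂ) ≠ 0 := by
    rw [Nat.cast_ne_zero]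
    omega
  rw [← mul_right_cancel₀ hn0 htr, Matrix.mul_assoc, ← Matrix.mul_assoc Φ, hA, Matrix.smul_mul,
    Matrix.one_mul, Matrix.mul_smul]

/-- The Welch bound is attained. -/
theorem IsETF.norm_gram {n : ℕ} (hn : 1 ≤ n) {Φ : Matrix (Fin n) (Fin n ⊕ Fin n) ℂ}
    (h : IsETF Φ) {i j : Fin n ⊕ Fin n} (hij : i ≠ j) :
    ‖(Φᴴ * Φ) i j‖ = 1 / Real.sqrt (2 * n - 1) := by
  have hsq := congrFun (congrFun (h.gram_sq hn) i) i
  obtain ⟨c, hc⟩ := h.equiangular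
  obtain ⟨G, hG⟩ : ∃ G, G = Φᴴ * Φ := ⟨_, rfl⟩
  have hGH : Gᴴ = G := by
    rw [hG, Matrix.conjTranspose_mul, conjTranspose_conjTranspose]
  have hunit := h.unit_norm
  rw [← hG] at hsq hc hunit ⊢
  have hterm : ∀ k, G i k * G k i = ((‖G i k‖ ^ 2 : ℝ) : ℂ) := by
    intro k
    have h1 : G k i = star (G i k) := by
      rw [← conjTranspose_apply, hGH]
    rw [h1, ← starRingEnd_apply, Complex.mul_conj, Complex.normSq_eq_norm_sq]
  rw [mul_apply, Finset.sum_congr rfl fun k _ => hterm k, ← Complex.ofReal_sum, Matrix.smul_apply, hunit,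
    smul_eq_mul, mul_one] at hsq
  have hsum : ∑ k, ‖G i k‖ ^ 2 = 2 := by exact_mod_cast hsq
  -- The (i, i) entry of G² = 2G becomes 1 + (2n - 1)c² = 2.
  rw [← Finset.add_sum_erase _ _ (Finset.mem_univ i), hunit, Finset.sum_congr rfl fun k hk => by
    rw [hc i k (Finset.ne_of_mem_erase hk).symm], Finset.sum_const,
    Finset.card_erase_of_mem (Finset.mem_univ i), Finset.card_univ, Fintype.card_sum,
    Fintype.card_fin, nsmul_eq_mul, Nat.cast_sub (by omega), norm_one] at hsum
  push_cast at hsum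
  have hc0 : 0 ≤ c := by
    rw [← hc i j hij]
    exact norm_nonneg _
  have hpos : (0 : ℝ) < 2 * n - 1 := by
    have : (1 : ℝ) ≤ n := by exact_mod_cast hn
    linarith
  rw [hc i j hij, eq_div_iff (Real.sqrt_pos.2 hpos).ne']
  refine (pow_eq_one_iff_of_nonneg (by positivity) two_ne_zero).1 ?_
  rw [mul_pow, Real.sq_sqrt hpos.le]
  linarith

/-! ### Matrix coefficients -/

/-- The diagonal matrix coefficient of the defining representation at a vector. -/
def coeff {n : ℕ} (v : Fin n → ℂ) (g : unitaryGroup (Fin n) ℂ) : ℂ :=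
  star v ⬝ᵥ ((g : Matrix (Fin n) (Fin n) ℂ) *ᵥ v)

theorem star_mulVec_dotProduct_mulVec {n : ℕ} (v : Fin n → ℂ) (g h : unitaryGroup (Fin n) ℂ) :
    star ((g : Matrix (Fin n) (Fin n) ℂ) *ᵥ v) ⬝ᵥ ((h : Matrix (Fin n) (Fin n) ℂ) *ᵥ v) =
      coeff v (g⁻¹ * h) := by
  rw [coeff, star_mulVec, ← dotProduct_mulVec, mulVec_mulVec]
  rfl

theorem coeff_inv {n : ℕ} (v : Fin n → ℂ) (g : unitaryGroup (Fin n) ℂ) :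
    coeff v g⁻¹ = star (coeff v g) := by
  have h := star_mulVec_dotProduct_mulVec v g 1
  rw [mul_one] at h
  rw [← h, coeff, star_dotProduct, UnitaryGroup.one_val, one_mulVec]

theorem coeff_phase_mul {n : ℕ} (v : Fin n → ℂ) (z : Circle) (g : unitaryGroup (Fin n) ℂ) :
    coeff v (phase n z * g) = z * coeff v g := by
  rw [coeff, coe_phase_mul, smul_mulVec, dotProduct_smul, smul_eq_mul, coeff]

theorem coeff_one {n : ℕ} (v : EuclideanSpace ℂ (Fin n)) (hv : ‖v‖ = 1) :
    coeff (WithLp.ofLp v) 1 = 1 := by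
  have h := inner_self_eq_norm_sq_to_K (𝕜 := ℂ) v
  rw [hv, EuclideanSpace.inner_eq_star_dotProduct] at h
  rw [coeff, UnitaryGroup.one_val, one_mulVec, dotProduct_comm, h]
  simp

/-! ### Extraction of the sign matrices -/

theorem eq_mul_sign_of_im_eq_zero {z : ℂ} {s : ℝ} (him : z.im = 0) (hs : ‖z‖ = s) :
    z = (s : ℂ) * ((if 0 < z.re then 1 else -1 : ℤ) : ℂ) := by
  have h : |z.re| = s := by rw [← hs, Complex.abs_re_eq_norm.2 him]
  apply Complex.ext
  · split_ifs with h0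
    · simp [← h, abs_of_pos h0]
    · simp [← h, abs_of_nonpos (not_lt.1 h0)]
  · split_ifs <;> simp [him]

theorem eq_mul_I_mul_sign_of_re_eq_zero {z : ℂ} {s : ℝ} (hre : z.re = 0) (hs : ‖z‖ = s) :
    z = (s : ℂ) * Complex.I * ((if 0 < z.im then 1 else -1 : ℤ) : ℂ) := by
  have h : |z.im| = s := by rw [← hs, Complex.abs_im_eq_norm.2 hre]
  apply Complex.ext
  · split_ifs <;> simp [hre]
  · split_ifs with h0
    · simp [← h, abs_of_pos h0]
    · simp [← h, abs_of_nonpos (not_lt.1 h0)]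

/-- Entrywise inclusion of integer matrices into complex matrices. -/
def complexify (n : ℕ) : Matrix (Fin n) (Fin n) ℤ →+* Matrix (Fin n) (Fin n) ℂ :=
  (Int.castRingHom ℂ).mapMatrix

theorem complexify_apply {n : ℕ} (N : Matrix (Fin n) (Fin n) ℤ) (i j : Fin n) :
    complexify n N i j = (N i j : ℂ) := rfl

theorem complexify_transpose {n : ℕ} (N : Matrix (Fin n) (Fin n) ℤ) :
    complexify n Nᵀ = (complexify n N)ᵀ := rfl

theorem complexify_injective (n : ℕ) : Function.Injective (complexify n) := by
  intro X Y h
  ext i j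
  have h1 := congrFun (congrFun h i) j
  rw [complexify_apply, complexify_apply] at h1
  exact_mod_cast h1

/-- Skewness makes Pᵀ = 2I - P a polynomial in P, so P is normal; commutation of P and Q kills the
off-diagonal blocks of HHᵀ. -/
theorem isSkewHadamard_fromBlocks {n : ℕ} (hn : 1 ≤ n) {P Q : Matrix (Fin n) (Fin n) ℤ}
    (hP1 : ∀ i j, P i j = 1 ∨ P i j = -1) (hQ1 : ∀ i j, Q i j = 1 ∨ Q i j = -1)
    (hskew : P + Pᵀ = (2 : ℤ) • 1) (hPQ : P * Q = Q * P) (hQQ : Qᵀ * Q = Q * Qᵀ)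
    (hsum : P * Pᵀ + Q * Qᵀ = (2 * n : ℤ) • 1) :
    IsSkewHadamard (fromBlocks P Q (-Qᵀ) Pᵀ) := by
  have hu : ∀ x : ℤ, x = 1 ∨ x = -1 → x ∈ unitary ℤ := by
    rintro x (rfl | rfl) <;> simp [Unitary.mem_iff]
  have hPT : Pᵀ = (2 : ℤ) • 1 - P := by rw [← hskew]; abel
  have hPP : Pᵀ * P = P * Pᵀ := by
    rw [hPT, sub_mul, mul_sub, smul_mul_assoc, one_mul, mul_smul_comm, mul_one]
  constructor
  · refine IsHadamard.of_mul_conjTranspose ?_ ?_ ?_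
    · rintro (i | i) (j | j)
      · exact hu _ (hP1 i j)
      · exact hu _ (hQ1 i j)
      · refine hu _ ?_
        rcases hQ1 j i with h | h <;> simp [h]
      · exact hu _ (hP1 j i)
    · rw [conjTranspose_eq_transpose_of_trivial, fromBlocks_transpose, fromBlocks_multiply,
        ← fromBlocks_one, fromBlocks_smul, fromBlocks_inj, transpose_neg, transpose_transpose,
        transpose_transpose]
      have hcard : ((Fintype.card (Fin n ⊕ Fin n) : ℕ) : ℤ) = 2 * n := by
        simp
        ring
      have hPQ' : Pᵀ * Qᵀ = Qᵀ * Pᵀ := by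
        rw [← transpose_mul, ← transpose_mul, hPQ]
      rw [hcard]
      refine ⟨hsum, ?_, ?_, ?_⟩
      · rw [mul_neg, hPQ, neg_add_cancel, smul_zero]
      · rw [neg_mul, hPQ', neg_add_cancel, smul_zero]
      · rw [neg_mul_neg, hQQ, hPP, add_comm, hsum]
    · apply IsRegular.of_ne_zero
      simp
      omega
  · rw [fromBlocks_transpose, fromBlocks_add, hskew, transpose_transpose, add_comm Pᵀ, hskew,
      transpose_neg, transpose_transpose, add_neg_cancel, neg_add_cancel, ← fromBlocks_one,
      fromBlocks_smul, smul_zero]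

/-- A Hadamard order above 2 is divisible by 4, here 4 ∣ 2n. -/
theorem IsSkewHadamard.even {n : ℕ} (hn : 2 ≤ n)
    {H : Matrix (Fin n ⊕ Fin n) (Fin n ⊕ Fin n) ℤ} (hH : IsSkewHadamard H) : Even n := by
  have h := hH.1.four_dvd_card (by rw [Fintype.card_sum, Fintype.card_fin]; omega)
  rw [Fintype.card_sum, Fintype.card_fin] at h
  rw [Nat.even_iff]
  omega

/-- The structure theorem for Gram matrices built from two quasiperiodic sequences. -/
theorem exists_sign_matrices {n : ℕ} (hn : 1 ≤ n) {α : ℂ} (hα : α * α = 1) {a b : ℤ → ℂ}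
    (ha : ∀ k, a (k + n) = α * a k) (hb : ∀ k, b (k + n) = α * b k) (ha0 : a 0 = 1)
    (haH : ∀ k, a (-k) = star (a k)) (hbH : ∀ k, star (b k) = b k)
    (hA : IsUnit (toeplitz n a)) {G : Matrix (Fin n ⊕ Fin n) (Fin n ⊕ Fin n) ℂ}
    (hG : G = fromBlocks (toeplitz n a) (toeplitz n b) (toeplitz n b)ᵀ (toeplitz n a)ᵀ)
    (hGG : G * G = (2 : ℂ) • G)
    (hnorm : ∀ i j, i ≠ j → ‖G i j‖ = 1 / Real.sqrt (2 * n - 1)) :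
    ∃ P Q : Matrix (Fin n) (Fin n) ℤ, IsNegacirculant P ∧ IsNegacirculant Q ∧
      IsSkewHadamard (fromBlocks P Q (-Qᵀ) Pᵀ) ∧ G = gramOfBlocks P Q ∧
      (2 ≤ n → Even n ∧ α = -1) := by
  obtain ⟨s, hs⟩ : ∃ s : ℝ, s = 1 / Real.sqrt (2 * n - 1) := ⟨_, rfl⟩
  rw [← hs] at hnorm
  have hpos : (0 : ℝ) < 2 * n - 1 := by
    have : (1 : ℝ) ≤ n := by exact_mod_cast hn
    linarith
  have hs0 : 0 < s := by rw [hs]; positivity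
  have hs2 : (s : ℂ) * s * (2 * n - 1) = 1 := by
    have h : s * s * (2 * n - 1) = 1 := by
      rw [hs, div_mul_div_comm, Real.mul_self_sqrt hpos.le, one_mul, one_div,
        inv_mul_cancel₀ hpos.ne']
    exact_mod_cast h
  have hsC : (s : ℂ) ≠ 0 := by exact_mod_cast hs0.ne'
  obtain ⟨A, hAdef⟩ : ∃ A, A = toeplitz n a := ⟨_, rfl⟩
  obtain ⟨B, hBdef⟩ : ∃ B, B = toeplitz n b := ⟨_, rfl⟩
  have hAij : ∀ i j, A i j = a ((j : ℤ) - i) := fun i j => by rw [hAdef]; rfl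
  have hBij : ∀ i j, B i j = b ((j : ℤ) - i) := fun i j => by rw [hBdef]; rfl
  have hAH : Aᴴ = A := by
    ext i j
    rw [conjTranspose_apply, hAij, hAij, ← haH, neg_sub]
  have hBH : Bᴴ = Bᵀ := by
    ext i j
    rw [conjTranspose_apply, transpose_apply, hBij, hbH]
  have ha' := neg_index_quasiperiodic hα ha
  have hb' := neg_index_quasiperiodic hα hb
  have hAB : A * B = B * A := by rw [hAdef, hBdef, toeplitz_mul_comm ha hb]
  have hATB : Aᵀ * B = B * Aᵀ := by
    rw [hAdef, hBdef, toeplitz_transpose, toeplitz_mul_comm ha' hb]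
  have hAAT : Aᵀ * A = A * Aᵀ := by
    rw [hAdef, toeplitz_transpose, toeplitz_mul_comm ha' ha]
  have hBBT : Bᵀ * B = B * Bᵀ := by
    rw [hBdef, toeplitz_transpose, toeplitz_mul_comm hb' hb]
  rw [← hAdef] at hA
  rw [← hAdef, ← hBdef] at hG
  have hGG' := hGG
  rw [hG, fromBlocks_multiply, fromBlocks_smul, fromBlocks_inj] at hGG'
  obtain ⟨h11, h12, -, -⟩ := hGG'
  have htr : A.trace = n := by
    simp [trace, hAij, ha0]
  have hsum := add_transpose_eq_two hA hAH htr hATB hAAT h11 h12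
  have hnormA : ∀ i j, i ≠ j → ‖A i j‖ = s := by
    intro i j hij
    have h := hnorm (Sum.inl i) (Sum.inl j) (by simpa using hij)
    rwa [hG, fromBlocks_apply₁₁] at h
  have hnormB : ∀ i j, ‖B i j‖ = s := by
    intro i j
    have h := hnorm (Sum.inl i) (Sum.inr j) (by simp)
    rwa [hG, fromBlocks_apply₁₂] at h
  have hAre : ∀ i j, i ≠ j → (A i j).re = 0 := by
    intro i j hij
    have h1 := congrFun (congrFun hsum i) j
    rw [Matrix.add_apply, transpose_apply, Matrix.smul_apply, one_apply_ne hij, smul_zero] at h1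
    have h2 : A j i = star (A i j) := by rw [← conjTranspose_apply, hAH]
    rw [h2] at h1
    have h3 := congrArg Complex.re h1
    simp at h3
    linarith
  have hAone : ∀ i, A i i = 1 := fun i => by rw [hAij, sub_self, ha0]
  have hBim : ∀ i j, (B i j).im = 0 := fun i j => by
    rw [hBij]
    exact Complex.conj_eq_iff_im.1 (hbH _)
  let P : Matrix (Fin n) (Fin n) ℤ :=
    Matrix.of fun i j => if i = j then 1 else if 0 < (A i j).im then 1 else -1
  let Q : Matrix (Fin n) (Fin n) ℤ := Matrix.of fun i j => if 0 < (B i j).re then 1 else -1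
  have hPdiag : ∀ i, P i i = 1 := fun i => by simp [P]
  have hPoff : ∀ i j, i ≠ j → P i j = if 0 < (A i j).im then 1 else -1 := fun i j hij => by
    simp [P, hij]
  have hP1 : ∀ i j, P i j = 1 ∨ P i j = -1 := fun i j => by
    simp only [P, of_apply]
    split_ifs <;> simp
  have hQ1 : ∀ i j, Q i j = 1 ∨ Q i j = -1 := fun i j => by
    simp only [Q, of_apply]
    split_ifs <;> simp
  have hQ : B = (s : ℂ) • complexify n Q := by
    ext i j
    rw [Matrix.smul_apply, complexify_apply, smul_eq_mul]
    exact eq_mul_sign_of_im_eq_zero (hBim i j) (hnormB i j)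
  have hPc : A = 1 + ((s : ℂ) * Complex.I) • (complexify n P - 1) := by
    ext i j
    rw [Matrix.add_apply, Matrix.smul_apply, Matrix.sub_apply, complexify_apply, smul_eq_mul]
    by_cases hij : i = j
    · subst hij
      rw [hPdiag, hAone, one_apply_eq]
      simp
    · rw [one_apply_ne hij, hPoff i j hij, sub_zero, zero_add]
      exact eq_mul_I_mul_sign_of_re_eq_zero (hAre i j hij) (hnormA i j hij)
  have hsI : (s : ℂ) * Complex.I ≠ 0 := mul_ne_zero hsC Complex.I_ne_zero
  have hPA : complexify n P = 1 + ((s : ℂ) * Complex.I)⁻¹ • (A - 1) := by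
    rw [hPc, add_sub_cancel_left, smul_smul, inv_mul_cancel₀ hsI, one_smul, add_sub_cancel]
  have hQB : complexify n Q = (s : ℂ)⁻¹ • B := by
    rw [hQ, smul_smul, inv_mul_cancel₀ hsC, one_smul]
  have hskew' : complexify n P + (complexify n P)ᵀ = (2 : ℂ) • 1 := by
    have hAT : Aᵀ = (2 : ℂ) • 1 - A := by rw [← hsum]; abel
    rw [hPA, transpose_add, transpose_smul, transpose_sub, transpose_one, hAT]
    module
  have hskew : P + Pᵀ = (2 : ℤ) • 1 := by
    apply complexify_injective
    rw [map_add, complexify_transpose, hskew', map_zsmul, map_one]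
    module
  have hPQ : P * Q = Q * P := by
    apply complexify_injective
    rw [map_mul, map_mul, hPA, hQB, add_mul, mul_add, one_mul, mul_one, smul_mul_smul_comm,
      smul_mul_smul_comm, sub_mul, mul_sub, one_mul, mul_one, hAB, mul_comm (s : ℂ)⁻¹]
  have hQQ' : (complexify n Q)ᵀ * complexify n Q = complexify n Q * (complexify n Q)ᵀ := by
    rw [hQB, transpose_smul, smul_mul_smul_comm, smul_mul_smul_comm, hBBT]
  have hQQ : Qᵀ * Q = Q * Qᵀ := by
    apply complexify_injective
    rw [map_mul, map_mul, complexify_transpose, hQQ']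
  have hPPQQ : P * Pᵀ + Q * Qᵀ = (2 * n : ℤ) • 1 := by
    apply complexify_injective
    rw [map_add, map_mul, map_mul, complexify_transpose, complexify_transpose, map_zsmul, map_one]
    have hPT : (complexify n P)ᵀ = (2 : ℂ) • 1 - complexify n P := by rw [← hskew']; abel
    -- Completing the square in `h11`; substituting A - I = is(P - I) and B = sQ, then multiplying
    -- by 2n - 1 = s⁻², gives -(P - I)² + QQᵀ = (2n - 1)I.
    have h1 : (A - 1) * (A - 1) + B * Bᵀ = 1 := by
      have h2 : (A - 1) * (A - 1) + B * Bᵀ = (A * A + B * Bᵀ) - (2 : ℂ) • A + 1 := by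
        simp only [sub_mul, mul_sub, one_mul, mul_one]
        module
      rw [h2, h11, sub_self, zero_add]
    have h3 : A - 1 = ((s : ℂ) * Complex.I) • (complexify n P - 1) := by
      rw [hPc, add_sub_cancel_left]
    have hII : (s : ℂ) * Complex.I * (s * Complex.I) = -(s * s) := by
      rw [mul_mul_mul_comm, Complex.I_mul_I, mul_neg_one]
    rw [h3, hQ, transpose_smul, smul_mul_smul_comm, smul_mul_smul_comm, hII] at h1
    have h4 : ((2 * n - 1 : ℂ)) • (-((s : ℂ) * s) • ((complexify n P - 1) * (complexify n P - 1)) +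
        ((s : ℂ) * s) • (complexify n Q * (complexify n Q)ᵀ)) =
        (2 * n - 1 : ℂ) • (1 : Matrix (Fin n) (Fin n) ℂ) := by rw [h1]
    have h5 : (2 * n - 1 : ℂ) * (s * s) = 1 := by rw [mul_comm, hs2]
    rw [smul_add, smul_smul, smul_smul, mul_neg, h5, neg_one_smul, one_smul] at h4
    have h6 : complexify n P * (complexify n P)ᵀ =
        1 - (complexify n P - 1) * (complexify n P - 1) := by
      rw [hPT]
      simp only [sub_mul, mul_sub, one_mul, mul_one, mul_smul_comm]
      module
    rw [h6, sub_eq_add_neg, add_assoc, h4, ← Int.cast_smul_eq_zsmul ℂ]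
    push_cast
    module
  have hH := isSkewHadamard_fromBlocks hn hP1 hQ1 hskew hPQ hQQ hPPQQ
  have hsign : 2 ≤ n → Even n ∧ α = -1 := by
    intro hn2
    have heven := hH.even hn2
    refine ⟨heven, (mul_self_eq_one_iff.1 hα).resolve_left ?_⟩
    rintro rfl
    -- With n = 2m and α = 1, a(m) = a(-m) is its own conjugate, yet it is an imaginary entry of
    -- modulus s > 0.
    obtain ⟨m, hm⟩ := heven
    have hne : (⟨0, by omega⟩ : Fin n) ≠ ⟨m, by omega⟩ := by
      intro h
      have := congrArg Fin.val h
      dsimp only at this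
      omega
    have h1 := hnormA _ _ hne
    have h2 := hAre _ _ hne
    have h3 := ha (-m)
    rw [one_mul, haH, show -(m : ℤ) + n = m by omega] at h3
    have h4 : A ⟨0, by omega⟩ ⟨m, by omega⟩ = a m := by
      rw [hAij]
      simp
    rw [h4] at h1 h2
    have h5 : (a m).im = 0 := Complex.conj_eq_iff_im.1 h3.symm
    rw [Complex.ext (w := 0) h2 h5, norm_zero] at h1
    exact hs0.ne h1
  refine ⟨P, Q, ?_, ?_, hH, ?_, hsign⟩
  -- For n = 1 nothing wraps around, so the sign of α is irrelevant.
  · rcases hn.eq_or_lt with rfl | hn2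
    · exact isNegacirculant_one
    · obtain ⟨-, rfl⟩ := hsign hn2
      -- This symbol is real-linear in a, so it keeps the multiplier -1. It is 1 at k = 0, and on
      -- the other diagonals only Im a / s survives.
      refine isNegacirculant_of_map_eq_toeplitz
        (a := fun k => ((a k).re + (a k).im / s : ℝ)) (fun k => ?_) ?_
      · rw [ha]
        simp
        ring
      · ext i j
        change complexify n P i j = _
        rw [toeplitz, of_apply, ← hAij]
        by_cases hij : i = j
        · subst hij
          rw [hAone, complexify_apply, hPdiag]
          simp
        · rw [hPA, hAre i j hij, Matrix.add_apply, Matrix.smul_apply, Matrix.sub_apply,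
            one_apply_ne hij, sub_zero, zero_add, zero_add, smul_eq_mul, inv_mul_eq_iff_eq_mul₀ hsI]
          apply Complex.ext
          · simp [hAre i j hij]
          · simp
            field_simp
  · rcases hn.eq_or_lt with rfl | hn2
    · exact isNegacirculant_one
    · obtain ⟨-, rfl⟩ := hsign hn2
      refine isNegacirculant_of_map_eq_toeplitz (a := fun k => (s : ℂ)⁻¹ * b k) (fun k => ?_) ?_
      · rw [hb]
        ring
      · ext i j
        change complexify n Q i j = _
        rw [hQB, hBdef]
        rfl
  · have hAT : Aᵀ = 1 + ((s : ℂ) * Complex.I) • (-complexify n P + 1) := by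
      have h : Aᵀ = (2 : ℂ) • 1 - A := by rw [← hsum]; abel
      rw [h, hPc]
      module
    change G = 1 + ((1 / Real.sqrt (2 * (n : ℝ) - 1) : ℝ) : ℂ) •
      fromBlocks (Complex.I • (complexify n P - 1)) (complexify n Q) (complexify n Q)ᵀ
        (Complex.I • (-complexify n P + 1))
    rw [hG, ← hs, fromBlocks_smul, ← fromBlocks_one, fromBlocks_add, smul_smul, smul_smul, zero_add,
      zero_add, ← transpose_smul, ← hQ, ← hPc, ← hAT]

/-! ### Rescaled dihedral configurations -/

/-- The elements of the unitary group which produce a rescaled dihedral configuration. -/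
def rescaledElement {n : ℕ} (M T : unitaryGroup (Fin n) ℂ) :
    Fin n ⊕ Fin n → unitaryGroup (Fin n) ℂ
  | Sum.inl i => M ^ (i : ℕ)
  | Sum.inr i => M ^ (i : ℕ) * T

/-- The configuration with columns `M ^ i v` and `M ^ i T v`. -/
def rescaledConfiguration {n : ℕ} (M T : unitaryGroup (Fin n) ℂ) (v : Fin n → ℂ) :
    Matrix (Fin n) (Fin n ⊕ Fin n) ℂ :=
  Matrix.of fun k j => ((rescaledElement M T j : Matrix (Fin n) (Fin n) ℂ) *ᵥ v) k

theorem rescaledConfiguration_eq_mul_diagonal {n : ℕ} {M T : unitaryGroup (Fin n) ℂ}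
    {π : DihedralGroup n → unitaryGroup (Fin n) ℂ} {e : Fin n ⊕ Fin n → Circle}
    (he : ∀ j, rescaledElement M T j = phase n (e j) * π (dihedralElement n j))
    (v : EuclideanSpace ℂ (Fin n)) :
    rescaledConfiguration M T (WithLp.ofLp v) =
      dihedralConfiguration π v * diagonal fun j => (e j : ℂ) := by
  ext k j
  rw [mul_diagonal, rescaledConfiguration, of_apply, he, coe_phase_mul, smul_mulVec, Pi.smul_apply,
    smul_eq_mul, mul_comm]
  rfl

/-- The relation TMᵏ = M⁻ᵏT brings every quotient of two elements to the form Mᵏ or MᵏT; the sign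
change of k produces the transposes in the lower row. -/
theorem rescaledConfiguration_gram {n : ℕ} {M T : unitaryGroup (Fin n) ℂ} (hT : T * T = 1)
    (hTM : T * M * (T * M) = 1) (v : Fin n → ℂ) :
    (rescaledConfiguration M T v)ᴴ * rescaledConfiguration M T v =
      fromBlocks (toeplitz n fun k => coeff v (M ^ k)) (toeplitz n fun k => coeff v (M ^ k * T))
        (toeplitz n fun k => coeff v (M ^ k * T))ᵀ (toeplitz n fun k => coeff v (M ^ k))ᵀ := by
  have h : ∀ i j, ((rescaledConfiguration M T v)ᴴ * rescaledConfiguration M T v) i j =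
      coeff v ((rescaledElement M T i)⁻¹ * rescaledElement M T j) :=
    fun i j => star_mulVec_dotProduct_mulVec v _ _
  have hTi : T⁻¹ = T := inv_eq_of_mul_eq_one_left hT
  have hpow : ∀ i j : ℕ, (M ^ i)⁻¹ * M ^ j = M ^ ((j : ℤ) - i) := fun i j => by
    rw [sub_eq_neg_add, _root_.zpow_add, _root_.zpow_neg, zpow_natCast, zpow_natCast]
  have hTMk : ∀ k : ℤ, T * M ^ k = M ^ (-k) * T := fun k => by
    rw [_root_.zpow_neg, ← conj_pow_eq_inv hT hTM, mul_assoc, hT, mul_one]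
  ext i j
  rw [h]
  rcases i with i | i <;> rcases j with j | j
  · rw [fromBlocks_apply₁₁, toeplitz, of_apply]
    simp only [rescaledElement]
    rw [hpow]
  · rw [fromBlocks_apply₁₂, toeplitz, of_apply]
    simp only [rescaledElement]
    rw [← mul_assoc, hpow]
  · rw [fromBlocks_apply₂₁, transpose_apply, toeplitz, of_apply]
    simp only [rescaledElement]
    rw [_root_.mul_inv_rev, hTi, mul_assoc, hpow, hTMk, neg_sub]
  · rw [fromBlocks_apply₂₂, transpose_apply, toeplitz, of_apply]
    simp only [rescaledElement]
    rw [_root_.mul_inv_rev, hTi, mul_assoc, ← mul_assoc _ _ T, hpow, ← mul_assoc, hTMk, mul_assoc, hT,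
      mul_one, neg_sub]

/-- This block is the Gram matrix of the rescaled rotation orbit, which is a basis by regularity. -/
theorem isUnit_toeplitz_of_isRegular {n : ℕ} {M T : unitaryGroup (Fin n) ℂ} (hT : T * T = 1)
    (hTM : T * M * (T * M) = 1) {π : DihedralGroup n → unitaryGroup (Fin n) ℂ}
    {e : Fin n ⊕ Fin n → Circle}
    (he : ∀ j, rescaledElement M T j = phase n (e j) * π (dihedralElement n j))
    {v : EuclideanSpace ℂ (Fin n)} (hreg : IsRegular π v) :
    IsUnit (toeplitz n fun k => coeff (WithLp.ofLp v) (M ^ k)) := by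
  obtain ⟨V, hV⟩ : ∃ V : Matrix (Fin n) (Fin n) ℂ,
      V = (dihedralConfiguration π v).submatrix id Sum.inl := ⟨_, rfl⟩
  obtain ⟨D, hD⟩ : ∃ D : Matrix (Fin n) (Fin n) ℂ,
      D = diagonal fun i => (e (Sum.inl i) : ℂ) := ⟨_, rfl⟩
  have hVu : IsUnit V := by
    rw [← linearIndependent_cols_iff_isUnit, hV]
    exact hreg.1
  have hDu : IsUnit D := by
    rw [hD, isUnit_diagonal, Pi.isUnit_iff]
    exact fun i => (Circle.coe_ne_zero _).isUnit
  have hVD : (rescaledConfiguration M T (WithLp.ofLp v)).submatrix id Sum.inl = V * D := by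
    ext i j
    rw [rescaledConfiguration_eq_mul_diagonal he, submatrix_apply, mul_diagonal, hD, mul_diagonal,
      hV, submatrix_apply]
  have h : (toeplitz n fun k => coeff (WithLp.ofLp v) (M ^ k)) = (V * D)ᴴ * (V * D) := by
    rw [← hVD]
    ext i j
    have h1 := congrFun (congrFun (rescaledConfiguration_gram hT hTM (WithLp.ofLp v)) (Sum.inl i))
      (Sum.inl j)
    rw [fromBlocks_apply₁₁] at h1
    rw [← h1]
    rfl
  rw [h]
  have hu := hVu.mul hDu
  exact hu.star.mul hu

end DihedralETF

end

/-! ### The main theorem -/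

theorem mainTheorem2 (n : ℕ) (hn : 1 ≤ n)
    (π : DihedralGroup n → Matrix.unitaryGroup (Fin n) ℂ)
    (hπ : DihedralETF.IsProjectiveRep π)
    (v : EuclideanSpace ℂ (Fin n)) (hv : ‖v‖ = 1)
    (hreg : DihedralETF.IsRegular π v)
    (Φ : Matrix (Fin n) (Fin n ⊕ Fin n) ℂ)
    (hdih : DihedralETF.SwitchingEquiv Φ (DihedralETF.dihedralConfiguration π v))
    (hETF : DihedralETF.IsETF Φ) :
    (2 ≤ n → DihedralETF.IsGenuineProjective π) ∧
      ∃ P Q : Matrix (Fin n) (Fin n) ℤ,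
        DihedralETF.IsNegacirculant P ∧ DihedralETF.IsNegacirculant Q ∧
        DihedralETF.IsSkewHadamard (Matrix.fromBlocks P Q (-Qᵀ) Pᵀ) ∧
        ∃ Ψ : Matrix (Fin n) (Fin n ⊕ Fin n) ℂ,
          DihedralETF.SwitchingEquiv Φ Ψ ∧ Ψᴴ * Ψ = DihedralETF.gramOfBlocks P Q := by
  open DihedralETF in
  have hπ' : ∀ g h, ∃ z, π (g * h) = phase n z * (π g * π h) :=
    fun g h => (projEq_iff_exists_phase _ _).1 (hπ g h)
  obtain ⟨M, T, hT, hTM, ⟨α, hα⟩, ⟨zM, hzM⟩, ⟨zT, hzT⟩, hi, hiT⟩ :=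
    exists_dihedral_lift (phase n) phase_commute π hπ'
  choose e₁ he₁ using hi
  choose e₂ he₂ using hiT
  obtain ⟨e, he⟩ : ∃ e : Fin n ⊕ Fin n → Circle,
      ∀ j, rescaledElement M T j = phase n (e j) * π (dihedralElement n j) := by
    refine ⟨Sum.elim (fun i => e₁ i) (fun i => e₂ i), ?_⟩
    rintro (i | i)
    · exact he₁ i
    · exact he₂ i
  have hsw : SwitchingEquiv Φ (rescaledConfiguration M T (WithLp.ofLp v)) := by
    rw [rescaledConfiguration_eq_mul_diagonal he]
    exact hdih.mul_diagonal fun j => Circle.norm_coe _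
  have hE := hETF.of_switchingEquiv hsw
  have hαα : α * α = 1 := central_sq_eq_one (phase n) phase_commute (phase_injective hn) hT hTM hα
  have hshift : ∀ k : ℤ, M ^ (k + n) = phase n α * M ^ k := fun k => by
    rw [_root_.zpow_add, zpow_natCast, hα, (phase_commute α _).eq]
  obtain ⟨P, Q, hP, hQ, hH, hgram, hsign⟩ := exists_sign_matrices hn (α := (α : ℂ))
    (a := fun k => coeff (WithLp.ofLp v) (M ^ k)) (b := fun k => coeff (WithLp.ofLp v) (M ^ k * T))
    (by rw [← Circle.coe_mul, hαα, Circle.coe_one])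
    (fun k => by rw [hshift, coeff_phase_mul])
    (fun k => by rw [hshift, mul_assoc, coeff_phase_mul])
    (by rw [zpow_zero, coeff_one v hv])
    (fun k => by rw [_root_.zpow_neg, coeff_inv])
    -- MᵏT is its own inverse, so its coefficient is real.
    (fun k => by
      rw [← coeff_inv, _root_.mul_inv_rev, inv_eq_of_mul_eq_one_left hT, ← conj_pow_eq_inv hT hTM,
        ← mul_assoc, ← mul_assoc, hT, one_mul])
    (isUnit_toeplitz_of_isRegular hT hTM he hreg)
    (rescaledConfiguration_gram hT hTM _) (hE.gram_sq hn) fun i j hij => hE.norm_gram hn hij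
  refine ⟨fun hn2 => ⟨hπ, ?_⟩, P, Q, hP, hQ, hH, _, hsw, hgram⟩
  rintro ⟨ρ, U, hU⟩
  obtain ⟨heven, hneg⟩ := hsign hn2
  have hconj : ∀ g, ∃ z, π g = phase n z * (U⁻¹ * ρ g * U) := by
    intro g
    obtain ⟨z, hz⟩ := (projEq_iff_exists_phase (U * π g * U⁻¹) (ρ g)).1 (hU g)
    refine ⟨z, ?_⟩
    rw [← mul_assoc, ← mul_assoc, (phase_commute z U⁻¹).eq, mul_assoc U⁻¹, ← hz]
    group
  have hlift : ∀ (w : Circle) g, ∃ z, phase n w * π g = phase n z * (U⁻¹ * ρ g * U) := by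
    intro w g
    obtain ⟨z, hz⟩ := hconj g
    exact ⟨w * z, by rw [hz, map_mul, mul_assoc (phase n w)]⟩
  -- After conjugation by U⁻¹ the strict representation differs from `π`, hence from M and T, by
  -- phases alone; as n is even, Mⁿ = 1, against α = -1.
  let ρ' : DihedralGroup n →* Matrix.unitaryGroup (Fin n) ℂ :=
    (MulAut.conj U⁻¹).toMonoidHom.comp ρ
  have hρ' : ∀ g, ρ' g = U⁻¹ * ρ g * U := fun g => by simp [ρ']
  simp only [← hρ'] at hlift
  have hM1 : M ^ n = 1 := by
    refine pow_eq_one_of_even (phase n) phase_commute (phase_injective hn) heven hT hTM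
      (M' := ρ' (DihedralGroup.r 1)) (T' := ρ' (DihedralGroup.sr 0)) ?_ ?_ ?_ ?_ ?_
    · rw [← map_mul, DihedralGroup.sr_mul_self, map_one]
    · rw [← map_mul, ← map_mul, DihedralGroup.sr_mul_r, DihedralGroup.sr_mul_self, map_one]
    · rw [← map_pow, DihedralGroup.r_one_pow_n, map_one]
    · rw [hzM]
      exact hlift _ _
    · rw [hzT]
      exact hlift _ _
  have h1 : α = 1 := phase_injective hn (by rw [← hα, hM1, map_one])
  rw [h1, Circle.coe_one] at hneg
  norm_num at hneg
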